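/- Let $\mathcal A$ be a unital $C^*$-algebra, $d\ge 0$, and $\xi$ an action of $\mathbb Z^d$ on $\mathcal A$ by $*$-automorphisms. Let $\mathcal B=\mathcal A\rtimes_\xi\mathbb Z^d$ be the crossed product, i.e. the completion of the algebra of finite sums $\sum_q a_q\cdot q$ ($a_q\in\mathcal A$, $q\in\mathbb Z^d$) in the norm $\sup\|\sum_q\pi(a_q)U_q\|$ over all covariant representations $(\pi,U)$ of $(\mathcal A,\xi,\mathbb Z^d)$ on Hilbert spaces. Put $u_q=1\cdot q$. For $\lambda\in\mathbb T^d$ let $\rho_\lambda$ be the $*$-automorphism of $\mathcal B$ with $\rho_\lambda(\sum_q a_q\cdot q)=\sum_q\lambda^q a_q\cdot q$, where $\lambda^q=\lambda_1^{q_1}\cdots\lambda_d^{q_d}$. For $a\in\mathcal B$ and $q\in\mathbb Z^d$ let $\Phi_q(a)=\int_{\mathbb T^d}\rho_\lambda(a\,u_q^{-1})\,d\mu(\lambda)$ be the Fourier coefficients, with $\mu$ the normalized Haar measure. Let $|q|$ be the Euclidean length, and set $$\mathcal B_{\mathrm{loc}}=\Big\{a\in\mathcal B \ :\ \exists\,\alpha\in(0,1)\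 \text{ such that }\ \sup_{q\in\mathbb Z^d}\alpha^{-|q|}\,\|\Phi_q(a)\|<\infty\Big\}.$$ Then: (i) $\mathcal B_{\mathrm{loc}}$ is exactly the set of all $a\in\mathcal B$ for which there are $\varepsilon>0$ and an analytic map $F:\{z\in\mathbb C^d: 1-\varepsilon<|z_j|<1+\varepsilon \text{ for all } j\}\to\mathcal B$ with $F(\lambda)=\rho_\lambda(a)$ for all $\lambda\in\mathbb T^d$. (ii) $\mathcal B_{\mathrm{loc}}$ is a dense unital $*$-subalgebra of $\mathcal B$. (iii) $\mathcal B_{\mathrm{loc}}$ is stable under the holomorphic functional calculus of $\mathcal B$: if $a\in\mathcal B_{\mathrm{loc}}$ and $f$ is holomorphic on an open neighbourhood $V$ of the spectrum $\mathrm{sp}(a)$ of $a$ in $\mathcal B$, then $f(a)=\frac1{2\pi i}\oint_\Gamma f(z)(z-a)^{-1}\,dz$ belongs to $\mathcal B_{\mathrm{loc}}$. Here $\Gamma$ is any piecewise $C^1$ cycle in $V\setminus\mathrm{sp}(a)$ with winding number $1$ around each point of $\mathrm{sp}(a)$ and $0$ around each point outside $V$. Moreover, if $a\in\mathcal B_{\mathrm{loc}}$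 is invertible in $\mathcal B$, then $a^{-1}\in\mathcal B_{\mathrm{loc}}$. -/

import Mathlib

open MeasureTheory Set
open scoped ENNReal

universe u

noncomputable section

namespace CrossedProductZd

/-- The group `ℤ^d`, written multiplicatively. -/
abbrev Zd (d : ℕ) : Type := Multiplicative (Fin d → ℤ)

/-- The torus `𝕋^d`. -/
abbrev Torus (d : ℕ) : Type := Fin d → Circle

/-- The character `q ↦ λ^q = λ_1^{q_1} ⋯ λ_d^{q_d}` of `ℤ^d`. -/
def character {d : ℕ} (l : Torus d) : Zd d →* Circle where
  toFun q := ∏ j, l j ^ (q.toAdd j)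
  map_one' := by simp
  map_mul' p q := by simp [zpow_add, Finset.prod_mul_distrib]

section CrossedProduct

variable {A : Type u} [CStarAlgebra A] {d : ℕ} (ξ : Zd d →* (A ≃⋆ₐ[ℂ] A))

/-- A covariant representation `(π, U)` of the `C*`-dynamical system `(A, ξ, ℤ^d)` on a nonzero
Hilbert space `H`: a unital `*`-representation `π` of `A` and a unitary representation `U` of `ℤ^d`
with `U_q π(a) U_q^* = π(ξ_q(a))`. -/
structure CovariantRep where
  H : Type u
  [normedAddCommGroup : NormedAddCommGroup H]
  [innerProductSpace : InnerProductSpace ℂ H]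
  [completeSpace : CompleteSpace H]
  [nontrivial : Nontrivial H]
  π : A →⋆ₐ[ℂ] (H →L[ℂ] H)
  U : Zd d →* unitary (H →L[ℂ] H)
  covariant : ∀ q a, (U q : H →L[ℂ] H) * π a * star (U q : H →L[ℂ] H) = π (ξ q a)

attribute [instance] CovariantRep.normedAddCommGroup CovariantRep.innerProductSpace
  CovariantRep.completeSpace CovariantRep.nontrivial

/-- The operators on the space of a covariant representation. -/
abbrev Op (σ : CovariantRep ξ) : Type u := σ.H →L[ℂ] σ.H

/-- The bounded families `(x_σ)_σ` with `x_σ ∈ B(H_σ)`, where `σ` runs over all covariant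
representations, with the supremum norm and the pointwise operations. -/
abbrev Ambient : Type (u + 1) := lp (Op ξ) ∞

instance instCStarAlgebraAmbient : CStarAlgebra (Ambient ξ) where

variable {ξ}

/-- The universal image `(π_σ(a))_σ` of `a ∈ A`. -/
def ambientCoeff (a : A) : Ambient ξ :=
  ⟨fun σ => σ.π a, memℓp_infty ⟨‖a‖, by
    rintro _ ⟨σ, rfl⟩
    exact NonUnitalStarAlgHom.norm_apply_le σ.π a⟩⟩

/-- The universal image `(U_σ(q))_σ` of `q ∈ ℤ^d`. -/
def ambientUnitary (q : Zd d) : Ambient ξ :=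
  ⟨fun σ => (σ.U q : Op ξ σ), memℓp_infty ⟨1, by
    rintro _ ⟨σ, rfl⟩
    exact (CStarRing.norm_coe_unitary (σ.U q)).le⟩⟩

variable (ξ)

/-- The `*`-algebra generated by the universal images of `A` and `ℤ^d`. By covariance it is the set
of the finite sums `∑_q a_q · q`, that is, the image of the core algebra `A ℤ^d`; the norm of such a
sum is the supremum of `‖∑_q π(a_q) U_q‖` over all covariant representations `(π, U)`. -/
def core : StarSubalgebra ℂ (Ambient ξ) :=
  StarAlgebra.adjoin ℂ (range (ambientCoeff (ξ := ξ)) ∪ range (ambientUnitary (ξ := ξ)))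

/-- The crossed product `A ⋊_ξ ℤ^d`: the completion of the core algebra in the universal norm,
realized as the closure of its image under the universal covariant representation. -/
def CrossedProduct : Type (u + 1) := (core ξ).topologicalClosure

instance instCStarAlgebraCrossedProduct : CStarAlgebra (CrossedProduct ξ) :=
  haveI : IsClosed ((core ξ).topologicalClosure : Set (Ambient ξ)) :=
    (core ξ).isClosed_topologicalClosure
  inferInstanceAs (CStarAlgebra (core ξ).topologicalClosure)

/-- The inclusion of the crossed product in the algebra of bounded families. -/
def inclusion : CrossedProduct ξ →⋆ₐ[ℂ] Ambient ξ :=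
  (core ξ).topologicalClosure.subtype

variable {ξ}

/-- The element `a · 0` of the crossed product. -/
def coeff (a : A) : CrossedProduct ξ :=
  ⟨ambientCoeff a, (core ξ).le_topologicalClosure
    (StarAlgebra.subset_adjoin ℂ _ (Or.inl ⟨a, rfl⟩))⟩

/-- The element `u_q = 1 · q` of the crossed product. -/
def unitaryElt (q : Zd d) : CrossedProduct ξ :=
  ⟨ambientUnitary q, (core ξ).le_topologicalClosure
    (StarAlgebra.subset_adjoin ℂ _ (Or.inr ⟨q, rfl⟩))⟩

/-- A point of the circle as a scalar unitary operator. -/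
def scalarUnitary (H : Type u) [NormedAddCommGroup H] [InnerProductSpace ℂ H] [CompleteSpace H] :
    Circle →* unitary (H →L[ℂ] H) where
  toFun z := ⟨(z : ℂ) • 1, by
    have h : (z : ℂ) * starRingEnd ℂ (z : ℂ) = 1 := by
      rw [Complex.mul_conj, Circle.normSq_coe]; simp
    have h' : starRingEnd ℂ (z : ℂ) * (z : ℂ) = 1 := by rw [mul_comm]; exact h
    rw [Unitary.mem_iff]
    constructor <;> simp [star_smul, smul_smul, h, h']⟩
  map_one' := by ext; simp
  map_mul' z w := by ext; simp [smul_smul, mul_comm]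

/-- The covariant representation `(π, λU)` with `(λU)_q = λ^q U_q`. -/
@[reducible]
def twist (l : Torus d) (σ : CovariantRep ξ) : CovariantRep ξ where
  H := σ.H
  π := σ.π
  U :=
    { toFun := fun q => scalarUnitary σ.H (character l q) * σ.U q
      map_one' := by simp
      map_mul' := fun p q => by
        ext v
        simp [scalarUnitary, smul_smul, mul_comm] }
  covariant q a := by
    have h : starRingEnd ℂ (character l q : ℂ) * ((character l q : Circle) : ℂ) = 1 := by
      rw [mul_comm, Complex.mul_conj, Circle.normSq_coe]; simp
    rw [← σ.covariant q a]
    simp [scalarUnitary, star_smul, smul_smul, h]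

/-- The automorphism `(x_{(π,U)}) ↦ (x_{(π,λU)})` of the algebra of bounded families. -/
def ambientRho (l : Torus d) : Ambient ξ →⋆ₐ[ℂ] Ambient ξ where
  toFun x := ⟨fun σ => x (twist l σ), memℓp_infty ⟨‖x‖, by
    rintro _ ⟨σ, rfl⟩
    exact lp.norm_apply_le_norm ENNReal.top_ne_zero x (twist l σ)⟩⟩
  map_one' := rfl
  map_mul' _ _ := rfl
  map_zero' := rfl
  map_add' _ _ := rfl
  commutes' _ := rfl
  map_star' _ := rfl

theorem ambientRho_coeff (l : Torus d) (a : A) :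
    ambientRho l (ambientCoeff (ξ := ξ) a) = ambientCoeff a := rfl

theorem ambientRho_unitary (l : Torus d) (q : Zd d) :
    ambientRho l (ambientUnitary (ξ := ξ) q) = (character l q : ℂ) • ambientUnitary q := by
  refine lp.ext (funext fun σ => ?_)
  change ((scalarUnitary σ.H (character l q) * σ.U q : unitary (Op ξ σ)) : Op ξ σ) =
    (character l q : ℂ) • (σ.U q : Op ξ σ)
  simp [scalarUnitary]

theorem ambientRho_core (l : Torus d) : core ξ ≤ (core ξ).comap (ambientRho l) := by
  refine StarAlgebra.adjoin_le ?_
  rintro _ (⟨a, rfl⟩ | ⟨q, rfl⟩)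
  · change ambientRho l (ambientCoeff a) ∈ core ξ
    rw [ambientRho_coeff]
    exact StarAlgebra.subset_adjoin ℂ _ (Or.inl ⟨a, rfl⟩)
  · change ambientRho l (ambientUnitary q) ∈ core ξ
    rw [ambientRho_unitary]
    exact SMulMemClass.smul_mem _ (StarAlgebra.subset_adjoin ℂ _ (Or.inr ⟨q, rfl⟩))

theorem ambientRho_closure (l : Torus d) (x : Ambient ξ) (hx : x ∈ (core ξ).topologicalClosure) :
    ambientRho l x ∈ (core ξ).topologicalClosure := by
  have hc : Continuous (ambientRho (ξ := ξ) l) :=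
    AddMonoidHomClass.continuous_of_bound (ambientRho l) 1 fun x => by
      rw [one_mul]; exact NonUnitalStarAlgHom.norm_apply_le (ambientRho l) x
  exact map_mem_closure hc hx (fun y hy => ambientRho_core l hy)

/-- The automorphism `ρ_λ` of the crossed product, with
`ρ_λ(∑_q a_q · q) = ∑_q λ^q a_q · q` on the core algebra. -/
def rho (l : Torus d) : CrossedProduct ξ →⋆ₐ[ℂ] CrossedProduct ξ :=
  ((ambientRho l).comp (inclusion ξ)).codRestrict (core ξ).topologicalClosure
    (fun x => ambientRho_closure l _ x.2)

theorem rho_coeff (l : Torus d) (a : A) : rho l (coeff (ξ := ξ) a) = coeff a := rfl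

theorem rho_unitaryElt (l : Torus d) (q : Zd d) :
    rho l (unitaryElt (ξ := ξ) q) = (character l q : ℂ) • unitaryElt q :=
  Subtype.ext (ambientRho_unitary l q)

/-- The Fourier coefficient `Φ_q(a) = ∫_{𝕋^d} ρ_λ(a u_q^{-1}) dμ(λ)`, with `μ` the normalized Haar
measure and `𝕋^d` parametrized by `(ℝ/ℤ)^d`. -/
def fourierCoefficient (q : Zd d) (a : CrossedProduct ξ) : CrossedProduct ξ :=
  ∫ t : Fin d → UnitAddCircle, rho (fun j => (t j).toCircle) (a * unitaryElt q⁻¹)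
    ∂(Measure.pi fun _ => (AddCircle.haarAddCircle : Measure UnitAddCircle))

/-- The Euclidean length `|q|`. -/
def length (q : Zd d) : ℝ := Real.sqrt (∑ j, (q.toAdd j : ℝ) ^ 2)

variable (ξ)

/-- The elements with exponentially decaying Fourier coefficients. -/
def loc : Set (CrossedProduct ξ) :=
  {a | ∃ α : ℝ, 0 < α ∧ α < 1 ∧
    BddAbove (range fun q : Zd d => α ^ (-length q) * ‖fourierCoefficient q a‖)}

/-- A strip around `𝕋^d` in `ℂ^d`. -/
def strip (d : ℕ) (ε : ℝ) : Set (Fin d → ℂ) :=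
  {z | ∀ j, 1 - ε < ‖z j‖ ∧ ‖z j‖ < 1 + ε}

/-- The elements `a` for which `λ ↦ ρ_λ(a)` extends analytically to a strip around `𝕋^d`. -/
def analyticElements : Set (CrossedProduct ξ) :=
  {a | ∃ ε : ℝ, 0 < ε ∧ ∃ F : (Fin d → ℂ) → CrossedProduct ξ,
    AnalyticOnNhd ℂ F (strip d ε) ∧ ∀ l : Torus d, F (fun j => (l j : ℂ)) = rho l a}

end CrossedProduct

section HolomorphicCalculus

/-- A cycle in `ℂ`: finitely many `C¹` arcs, parametrized by `[0,1]`, that are linked end to start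
by a permutation, so that they form finitely many closed piecewise `C¹` curves. -/
structure Cycle where
  n : ℕ
  arc : Fin n → ℝ → ℂ
  contDiffOn : ∀ k, ContDiffOn ℝ 1 (arc k) (Icc 0 1)
  next : Equiv.Perm (Fin n)
  closed : ∀ k, arc k 1 = arc (next k) 0

/-- The contour integral `∮_Γ g(z) dz`. -/
def Cycle.integral (Γ : Cycle) {E : Type*} [NormedAddCommGroup E] [NormedSpace ℂ E]
    (g : ℂ → E) : E :=
  ∑ k, ∫ t in (0 : ℝ)..1, derivWithin (Γ.arc k) (Icc 0 1) t • g (Γ.arc k t)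

/-- The points of the plane through which a cycle passes. -/
def Cycle.support (Γ : Cycle) : Set ℂ := ⋃ k, Γ.arc k '' Icc 0 1

/-- The winding number of a cycle around a point off its support. -/
def Cycle.index (Γ : Cycle) (w : ℂ) : ℂ :=
  (2 * Real.pi * Complex.I)⁻¹ * Γ.integral fun z => (z - w)⁻¹

/-- The cycle `Γ` lies in `V \ K`, winds once around each point of `K` and does not wind around any
point outside `V`. -/
structure Cycle.Surrounds (Γ : Cycle) (K V : Set ℂ) : Prop where
  support_subset : Γ.support ⊆ V \ K
  index_eq_one : ∀ w ∈ K, Γ.index w = 1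
  index_eq_zero : ∀ w ∉ V, Γ.index w = 0

/-- `b = f(a)` in the holomorphic functional calculus: `f` is holomorphic on an open neighbourhood
`V` of the spectrum of `a`, and `b = (2πi)⁻¹ ∮_Γ f(z) (z - a)⁻¹ dz` for a cycle `Γ` in `V` that
surrounds the spectrum. -/
def IsHolomorphicCalculus {B : Type*} [CStarAlgebra B] (a : B) (f : ℂ → ℂ) (b : B) : Prop :=
  ∃ (V : Set ℂ) (Γ : Cycle), IsOpen V ∧ spectrum ℂ a ⊆ V ∧ DifferentiableOn ℂ f V ∧
    Γ.Surrounds (spectrum ℂ a) V ∧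
    b = (2 * Real.pi * Complex.I : ℂ)⁻¹ • Γ.integral fun z => f z • resolvent a z

/-- Stability of a subset under the holomorphic functional calculus. -/
def IsStableUnderHolomorphicCalculus {B : Type*} [CStarAlgebra B] (S : Set B) : Prop :=
  ∀ a ∈ S, ∀ (f : ℂ → ℂ) (b : B), IsHolomorphicCalculus a f b → b ∈ S

end HolomorphicCalculus

end CrossedProductZd

end

/-!
The Fourier coefficients intertwine the dual action with the characters:
`Φ_q(ρ_λ(a)) = λ^q Φ_q(a)` (`fourierCoefficient_rho`), and `‖Φ_q‖ ≤ 1`. Everything rests on this.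

If `λ ↦ ρ_λ(a)` extends to an analytic map `F` on a strip, compose `F` with the complex line
`ζ ↦ (exp(i s_j ζ))_j`, where `s_j` is the sign of `q_j`, and apply `Φ_q`. With
`|q|₁ = ∑_j |q_j|`, the result is `exp(i |q|₁ ζ) Φ_q(a)` for real `ζ`, so by the identity
theorem it is so for all `ζ` near the real line. At `ζ = -iδ` this says
`exp(δ |q|₁) ‖Φ_q(a)‖ ≤ sup ‖F‖`, which is exponential decay with constants that depend only
on the strip and on the bound of `F` (`norm_fourierCoefficient_le_of_analyticOnNhd`).
Conversely, if the coefficients decay exponentially, then `F(z) = ∑_q z^q Φ_q(a) u_q` is analytic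
on a strip (`analyticAt_tsum_monomial`), and it equals `ρ_λ(a)` on the torus because a scalar
function with summable Fourier coefficients is the sum of its Fourier series (`hasSum_fourier`).

Sums and products of analytic extensions are analytic extensions, and `Φ_q(a^*)` and `Φ_{-q}(a)`
have the same norm, so the elements with exponential decay form a `*`-subalgebra. It contains the
finite sums `∑_q a_q · q`, hence is dense.

For the holomorphic calculus, let `K` be a compact set off the spectrum of `a`. For `λ` in the torus
and `w ∈ K` the element `w - F(λ) = ρ_λ(w - a)` is invertible; by the tube lemma, `w - F(z)` is
invertible with bounded inverse for all `w ∈ K` and all `z` in one common strip. So the resolvents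
`(w - a)⁻¹`, `w ∈ K`, have exponentially decaying coefficients with common constants
(`exists_norm_fourierCoefficient_resolvent_le`). With `K` the trace of the cycle, the decay passes
through the contour integral, as `Φ_q` is linear and continuous; `K = {0}` gives inverses.
-/

namespace CrossedProductZd

open Filter Topology
open scoped NNReal

/-! ### Analyticity of Laurent series in several variables -/

/-- A series of analytic functions whose power series at `x` are jointly absolutely summable on a
ball is analytic at `x`: the double series may be summed in either order. -/
theorem analyticAt_tsum_of_summable_norm {ι E F : Type*} [NormedAddCommGroup E] [NormedSpace ℂ E]
    [NormedAddCommGroup F] [NormedSpace ℂ F] [CompleteSpace F] {f : ι → E → F}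
    {p : ι → FormalMultilinearSeries ℂ E F} {x : E} {r : ℝ≥0} (hr : 0 < r)
    (hf : ∀ i, HasFPowerSeriesOnBall (f i) (p i) x r)
    (hs : Summable fun k : ι × ℕ => ‖p k.1 k.2‖ * (r : ℝ) ^ k.2) :
    AnalyticAt ℂ (fun y => ∑' i, f i y) x := by
  have hs' : Summable fun k : ℕ × ι => ‖p k.2 k.1‖ * (r : ℝ) ^ k.1 :=
    (Equiv.prodComm ℕ ι).summable_iff.mpr hs
  have hn : ∀ n, Summable fun i => ‖p i n‖ := fun n => by
    have := (hs'.prod_factor n).mul_right (((r : ℝ) ^ n)⁻¹)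
    refine this.congr fun i => ?_
    have : (r : ℝ) ^ n ≠ 0 := by positivity
    field_simp
  let P : FormalMultilinearSeries ℂ E F := fun n => ∑' i, p i n
  have hP : HasFPowerSeriesOnBall (fun y => ∑' i, f i y) P x r := by
    refine ⟨P.le_radius_of_summable_norm ?_, by exact_mod_cast hr, ?_⟩
    · refine Summable.of_nonneg_of_le (fun n => by positivity) (fun n => ?_) hs'.prod
      change ‖P n‖ * (r : ℝ) ^ n ≤ ∑' i, ‖p i n‖ * (r : ℝ) ^ n
      rw [tsum_mul_right]
      gcongr
      exact norm_tsum_le_tsum_norm (hn n)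
    · intro y hy
      have hy' : ‖y‖ ≤ r := by
        have : ‖y‖₊ ≤ r := by simpa using (mem_eball_zero_iff.mp hy).le
        exact_mod_cast this
      have hg : Summable fun k : ι × ℕ => p k.1 k.2 fun _ => y := by
        refine Summable.of_norm_bounded hs fun k => ?_
        refine ((p k.1 k.2).le_opNorm _).trans ?_
        simp only [Finset.prod_const, Finset.card_univ, Fintype.card_fin]
        gcongr
      have hg' : HasSum (fun k : ℕ × ι => p k.2 k.1 fun _ => y)
          (∑' k : ι × ℕ, p k.1 k.2 fun _ => y) :=
        (Equiv.prodComm ℕ ι).hasSum_iff.mpr hg.hasSum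
      have h1 := hg.hasSum.prod_fiberwise fun i => (hf i).hasSum hy
      have h2 := hg'.prod_fiberwise fun n =>
        ContinuousMultilinearMap.hasSum_eval (hn n).of_norm.hasSum fun _ => y
      rw [h1.tsum_eq]
      exact h2
  exact hP.analyticAt

/-- A Laurent series `∑_q z^q c_q` is analytic at `z₀` when it converges absolutely with some room.
In the local coordinates `z_j = z₀_j exp(w_j)` the monomials become exponentials of the linear forms
`∑_j q_j w_j`, whose power series have explicit norms. -/
theorem analyticAt_tsum_monomial {B : Type*} [NormedAddCommGroup B] [NormedSpace ℂ B]
    [CompleteSpace B] {d : ℕ} (c : (Fin d → ℤ) → B) {z₀ : Fin d → ℂ} (hz₀ : ∀ j, z₀ j ≠ 0)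
    {r : ℝ≥0} (hr : 0 < r)
    (hs : Summable fun q => ‖c q‖ * ‖∏ j, z₀ j ^ q j‖ * Real.exp (r * ∑ j, |(q j : ℝ)|)) :
    AnalyticAt ℂ (fun z : Fin d → ℂ => ∑' q, (∏ j, z j ^ q j) • c q) z₀ := by
  -- `ℓ q` is the linear form `w ↦ ∑_j q_j w_j`.
  let ℓ : (Fin d → ℤ) → (Fin d → ℂ) →L[ℂ] ℂ := fun q =>
    ∑ j, (q j : ℂ) • ContinuousLinearMap.proj j
  have hℓ : ∀ q w, ℓ q w = ∑ j, (q j : ℂ) * w j := fun q w => by simp [ℓ]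
  have hℓn : ∀ q, ‖ℓ q‖ ≤ ∑ j, |(q j : ℝ)| := fun q => by
    refine (ℓ q).opNorm_le_bound (by positivity) fun w => ?_
    rw [hℓ, Finset.sum_mul]
    refine (norm_sum_le _ _).trans (Finset.sum_le_sum fun j _ => ?_)
    rw [norm_mul, Complex.norm_intCast]
    gcongr
    exact norm_le_pi_norm w j
  let g : (Fin d → ℤ) → ℂ →L[ℂ] B := fun q =>
    (ContinuousLinearMap.id ℂ ℂ).smulRight ((∏ j, z₀ j ^ q j) • c q)
  have hgn : ∀ q, ‖g q‖ = ‖c q‖ * ‖∏ j, z₀ j ^ q j‖ := fun q => by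
    simp only [g, ContinuousLinearMap.norm_smulRight_apply, ContinuousLinearMap.norm_id, one_mul,
      norm_smul]
    ring
  -- The series in the coordinates `w`, summed up through the exponential series of each `ℓ q`.
  have hG : AnalyticAt ℂ (fun w => ∑' q, g q (Complex.exp (ℓ q w))) 0 := by
    refine analyticAt_tsum_of_summable_norm (f := fun q w => g q (Complex.exp (ℓ q w)))
      (p := fun q => (g q).compFormalMultilinearSeries
        ((NormedSpace.expSeries ℂ ℂ).compContinuousLinearMap (ℓ q))) hr (fun q => ?_) ?_
    · have h0 : HasFPowerSeriesOnBall Complex.exp (NormedSpace.expSeries ℂ ℂ) (ℓ q 0) ∞ := by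
        rw [map_zero, Complex.exp_eq_exp_ℂ]
        exact NormedSpace.exp_hasFPowerSeriesOnBall
      have h1 := h0.compContinuousLinearMap
      rw [ENNReal.top_div_of_ne_top (by simp)] at h1
      exact ((g q).comp_hasFPowerSeriesOnBall h1).mono (by exact_mod_cast hr) le_top
    · have hle : ∀ q n, ‖(g q).compFormalMultilinearSeries
          ((NormedSpace.expSeries ℂ ℂ).compContinuousLinearMap (ℓ q)) n‖ * (r : ℝ) ^ n ≤
          ‖g q‖ * ((r * ∑ j, |(q j : ℝ)|) ^ n / n.factorial) := fun q n => by
        have h1 : ‖NormedSpace.expSeries ℂ ℂ n‖ ≤ 1 / n.factorial := by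
          rw [NormedSpace.expSeries, norm_smul, norm_inv, Complex.norm_natCast, one_div]
          refine mul_le_of_le_one_right (by positivity) ?_
          exact (ContinuousMultilinearMap.norm_mkPiAlgebraFin (𝕜 := ℂ) (A := ℂ)).le
        calc _ ≤ ‖g q‖ * ((1 / n.factorial) * (∑ j, |(q j : ℝ)|) ^ n) * (r : ℝ) ^ n := by
              gcongr
              refine ((g q).norm_compContinuousMultilinearMap_le _).trans ?_
              gcongr
              refine (FormalMultilinearSeries.norm_compContinuousLinearMap_le _ _ _).trans ?_
              gcongr
              exact hℓn q
          _ = _ := by rw [mul_pow]; ring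
      have hexp : ∀ t : ℝ, HasSum (fun n : ℕ => t ^ n / n.factorial) (Real.exp t) := fun t => by
        rw [Real.exp_eq_exp_ℝ]; exact NormedSpace.expSeries_div_hasSum_exp t
      refine Summable.of_nonneg_of_le (fun k => by positivity) (fun k => hle k.1 k.2) ?_
      rw [summable_prod_of_nonneg (fun k => by positivity)]
      refine ⟨fun q => (hexp (r * ∑ j, |(q j : ℝ)|)).summable.mul_left ‖g q‖, hs.congr fun q => ?_⟩
      simp only
      rw [tsum_mul_left, (hexp (r * ∑ j, |(q j : ℝ)|)).tsum_eq, hgn]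
  have hw : AnalyticAt ℂ (fun z : Fin d → ℂ => fun j => Complex.log (z j / z₀ j)) z₀ := by
    refine AnalyticAt.pi fun j => AnalyticAt.clog ?_ ?_
    · exact ((ContinuousLinearMap.proj (R := ℂ) (φ := fun _ : Fin d => ℂ) j).analyticAt z₀).div
        analyticAt_const (hz₀ j)
    · rw [div_self (hz₀ j)]; exact Complex.one_mem_slitPlane
  have hw0 : (fun j => Complex.log (z₀ j / z₀ j)) = 0 := by
    ext j; simp [div_self (hz₀ j)]
  have hcomp : AnalyticAt ℂ (fun z : Fin d → ℂ =>
      ∑' q, g q (Complex.exp (ℓ q fun j => Complex.log (z j / z₀ j)))) z₀ :=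
    AnalyticAt.comp (g := fun w => ∑' q, g q (Complex.exp (ℓ q w))) (by rw [hw0]; exact hG) hw
  refine hcomp.congr ?_
  have hev : ∀ᶠ z in 𝓝 z₀, ∀ j, z j ≠ 0 :=
    eventually_all.mpr fun j => (continuous_apply j).continuousAt.eventually_ne (hz₀ j)
  filter_upwards [hev] with z hz
  refine tsum_congr fun q => ?_
  simp only [g, ContinuousLinearMap.smulRight_apply, ContinuousLinearMap.id_apply, smul_smul]
  congr 1
  rw [hℓ, Complex.exp_sum, ← Finset.prod_mul_distrib]
  refine Finset.prod_congr rfl fun j _ => ?_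
  rw [Complex.exp_int_mul, Complex.exp_log (div_ne_zero (hz j) (hz₀ j)), div_zpow,
    div_mul_cancel₀ _ (zpow_ne_zero _ (hz₀ j))]

theorem analyticAt_inverse_algebraMap_sub {B E : Type*} [NormedRing B] [NormedAlgebra ℂ B]
    [CompleteSpace B] [NormedAddCommGroup E] [NormedSpace ℂ E] {f : E → B} {x : E} {w : ℂ}
    (hf : AnalyticAt ℂ f x) (hu : IsUnit (algebraMap ℂ B w - f x)) :
    AnalyticAt ℂ (fun y => Ring.inverse (algebraMap ℂ B w - f y)) x := by
  obtain ⟨u, hu⟩ := hu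
  have h : AnalyticAt ℂ Ring.inverse (algebraMap ℂ B w - f x) := hu ▸ analyticAt_inverse u
  exact h.comp (f := fun y => algebraMap ℂ B w - f y) (analyticAt_const.sub hf)

/-- The sum over `ℤ^d` of `β^(|q_1| + ⋯ + |q_d|)` is a product of `d` two-sided geometric series. -/
theorem summable_pow_sum_natAbs (d : ℕ) {β : ℝ} (h0 : 0 ≤ β) (h1 : β < 1) :
    Summable fun q : Fin d → ℤ => β ^ ∑ j, (q j).natAbs := by
  have h : Summable fun n : ℤ => β ^ n.natAbs := by
    refine Summable.of_nat_of_neg ?_ ?_ <;> simpa using summable_geometric_of_lt_one h0 h1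
  refine summable_of_sum_le (c := ∏ _j : Fin d, ∑' n : ℤ, β ^ n.natAbs) (fun q => by positivity)
    fun s => ?_
  calc ∑ q ∈ s, β ^ ∑ j, (q j).natAbs
      ≤ ∑ q ∈ Fintype.piFinset fun j => s.image fun q => q j, β ^ ∑ j, (q j).natAbs :=
        Finset.sum_le_sum_of_subset_of_nonneg
          (fun q hq => Fintype.mem_piFinset.mpr fun j => Finset.mem_image_of_mem _ hq)
          fun _ _ _ => by positivity
    _ = ∏ j, ∑ n ∈ s.image fun q => q j, β ^ n.natAbs := by
        simp_rw [Finset.prod_univ_sum, Finset.prod_pow_eq_pow_sum]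
    _ ≤ _ := Finset.prod_le_prod (fun _ _ => Finset.sum_nonneg fun _ _ => by positivity)
        fun j _ => h.sum_le_tsum _ fun _ _ => by positivity

/-! ### The crossed product, the dual action and the Fourier coefficients -/

variable {A : Type u} [CStarAlgebra A] {d : ℕ} {ξ : Zd d →* (A ≃⋆ₐ[ℂ] A)}

theorem star_unitaryElt (q : Zd d) : star (unitaryElt (ξ := ξ) q) = unitaryElt q⁻¹ := by
  refine Subtype.ext (lp.ext (funext fun σ => ?_))
  change star (σ.U q : Op ξ σ) = (σ.U q⁻¹ : Op ξ σ)
  rw [map_inv, ← Unitary.star_eq_inv, Unitary.coe_star]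

theorem unitaryElt_mul (p q : Zd d) :
    unitaryElt (ξ := ξ) (p * q) = unitaryElt p * unitaryElt q := by
  refine Subtype.ext (lp.ext (funext fun σ => ?_))
  change (σ.U (p * q) : Op ξ σ) = (σ.U p : Op ξ σ) * (σ.U q : Op ξ σ)
  rw [map_mul]
  rfl

theorem unitaryElt_one : unitaryElt (ξ := ξ) 1 = 1 := by
  refine Subtype.ext (lp.ext (funext fun σ => ?_))
  change (σ.U 1 : Op ξ σ) = 1
  rw [map_one]
  rfl

theorem unitaryElt_mem_unitary (q : Zd d) :
    unitaryElt (ξ := ξ) q ∈ unitary (CrossedProduct ξ) := by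
  rw [Unitary.mem_iff, star_unitaryElt, ← unitaryElt_mul, ← unitaryElt_mul]
  simp [unitaryElt_one]

theorem norm_mul_unitaryElt (a : CrossedProduct ξ) (q : Zd d) : ‖a * unitaryElt q‖ = ‖a‖ :=
  CStarRing.norm_mul_mem_unitary a (unitaryElt_mem_unitary q)

theorem norm_rho_le (l : Torus d) (a : CrossedProduct ξ) : ‖rho l a‖ ≤ ‖a‖ :=
  NonUnitalStarAlgHom.norm_apply_le (rho l) a

variable (ξ) in
/-- The `*`-subalgebra of finite sums `∑_q a_q · q` inside the crossed product. -/
noncomputable def finiteSums : StarSubalgebra ℂ (CrossedProduct ξ) :=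
  StarAlgebra.adjoin ℂ (range (coeff (ξ := ξ)) ∪ range (unitaryElt (ξ := ξ)))

theorem dense_finiteSums : Dense (finiteSums ξ : Set (CrossedProduct ξ)) := by
  have hind : IsInducing (inclusion ξ) := IsInducing.subtypeVal
  -- The inclusion maps the finite sums onto the core, so density can be read off in `Ambient ξ`.
  have hle : core ξ ≤ (finiteSums ξ).map (inclusion ξ) := by
    refine StarAlgebra.adjoin_le ?_
    rintro _ (⟨a, rfl⟩ | ⟨q, rfl⟩)
    · exact ⟨coeff a, StarAlgebra.subset_adjoin ℂ _ (Or.inl ⟨a, rfl⟩), rfl⟩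
    · exact ⟨unitaryElt q, StarAlgebra.subset_adjoin ℂ _ (Or.inr ⟨q, rfl⟩), rfl⟩
  intro x
  rw [hind.closure_eq_preimage_closure_image]
  exact closure_mono hle x.2

theorem coe_character (l : Torus d) (q : Zd d) :
    (character l q : ℂ) = ∏ j, (l j : ℂ) ^ q.toAdd j := by
  change Circle.coeHom (∏ j, l j ^ q.toAdd j) = _
  rw [map_prod]
  exact Finset.prod_congr rfl fun j _ => Circle.coe_zpow _ _

theorem continuous_character (q : Zd d) :
    Continuous fun l : Torus d => (character l q : ℂ) := by
  simp only [character, MonoidHom.coe_mk, OneHom.coe_mk]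
  fun_prop

theorem continuous_rho (a : CrossedProduct ξ) : Continuous fun l : Torus d => rho l a := by
  let S : StarSubalgebra ℂ (CrossedProduct ξ) :=
    { carrier := {a | Continuous fun l : Torus d => rho l a}
      mul_mem' := fun {a b} ha hb => by
        simp only [mem_ofPred_eq, map_mul] at *; exact ha.mul hb
      add_mem' := fun {a b} ha hb => by
        simp only [mem_ofPred_eq, map_add] at *; exact ha.add hb
      algebraMap_mem' := fun r => by
        simp only [mem_ofPred_eq, AlgHomClass.commutes]; exact continuous_const
      star_mem' := fun {a} ha => by
        simp only [mem_ofPred_eq, map_star] at *; exact ha.star }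
  have hS : finiteSums ξ ≤ S := by
    refine StarAlgebra.adjoin_le ?_
    rintro _ (⟨a, rfl⟩ | ⟨q, rfl⟩)
    · change Continuous fun l : Torus d => rho l (coeff a)
      simp only [rho_coeff]
      exact continuous_const
    · change Continuous fun l : Torus d => rho l (unitaryElt q)
      simp only [rho_unitaryElt]
      exact (continuous_character q).smul continuous_const
  -- As each `ρ_λ` is contractive, approximation of `a` is uniform in `λ`.
  refine continuous_of_uniform_approx_of_continuous fun u hu => ?_
  obtain ⟨ε, hε, hu⟩ := Metric.mem_uniformity_dist.mp hu
  obtain ⟨b, hb, hab⟩ := dense_finiteSums.exists_dist_lt a hε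
  refine ⟨fun l => rho l b, hS hb, fun l => hu ?_⟩
  rw [dist_eq_norm, ← map_sub]
  exact (norm_rho_le l _).trans_lt (by rwa [← dist_eq_norm])

theorem rho_mul (l m : Torus d) (a : CrossedProduct ξ) : rho (l * m) a = rho l (rho m a) := by
  have h : ∀ b ∈ finiteSums ξ, rho (l * m) b = rho l (rho m b) := by
    have : finiteSums ξ ≤ StarAlgHom.equalizer (rho (ξ := ξ) (l * m)) ((rho l).comp (rho m)) := by
      refine StarAlgebra.adjoin_le ?_
      rintro _ (⟨a, rfl⟩ | ⟨q, rfl⟩)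
      · rfl
      · change rho (l * m) (unitaryElt q) = rho l (rho m (unitaryElt q))
        have hc : character (l * m) q = character l q * character m q := by
          simp [character, mul_zpow, Finset.prod_mul_distrib]
        simp only [rho_unitaryElt, map_smul, hc, smul_smul, Circle.coe_mul]
        rw [mul_comm]
    exact this
  have hc : ∀ k : Torus d, Continuous (rho (ξ := ξ) k) := fun k =>
    AddMonoidHomClass.continuous_of_bound (rho k) 1 fun x => by rw [one_mul]; exact norm_rho_le k x
  exact congrFun (Continuous.ext_on dense_finiteSums (hc _) ((hc _).comp (hc _)) h) a

/-- The parametrization of `𝕋^d` by `(ℝ/ℤ)^d`. -/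
noncomputable def torusPoint (t : Fin d → UnitAddCircle) : Torus d := fun j => (t j).toCircle

theorem continuous_torusPoint : Continuous (torusPoint (d := d)) :=
  continuous_pi fun j => AddCircle.continuous_toCircle.comp (continuous_apply j)

theorem torusPoint_add (s t : Fin d → UnitAddCircle) :
    torusPoint (s + t) = torusPoint s * torusPoint t :=
  funext fun _ => AddCircle.toCircle_add _ _

theorem surjective_torusPoint : Function.Surjective (torusPoint (d := d)) := fun l =>
  ⟨fun j => (AddCircle.homeomorphCircle one_ne_zero).symm (l j), funext fun j => by
    rw [torusPoint, ← AddCircle.homeomorphCircle_apply one_ne_zero, Homeomorph.apply_symm_apply]⟩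

theorem character_torusPoint (t : Fin d → UnitAddCircle) (q : Zd d) :
    (character (torusPoint t) q : ℂ) = UnitAddTorus.mFourier q.toAdd t := by
  simp [coe_character, torusPoint, UnitAddTorus.mFourier, fourier_apply, AddCircle.toCircle_zsmul]

/-- The normalized Haar measure of `(ℝ/ℤ)^d`. -/
noncomputable abbrev haarTorus (d : ℕ) : Measure (Fin d → UnitAddCircle) :=
  Measure.pi fun _ => AddCircle.haarAddCircle

theorem integrable_rho (a : CrossedProduct ξ) :
    Integrable (fun t => rho (torusPoint t) a) (haarTorus d) :=
  ((continuous_rho a).comp continuous_torusPoint).integrable_of_hasCompactSupport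
    (HasCompactSupport.of_compactSpace _)

theorem fourierCoefficient_eq (q : Zd d) (a : CrossedProduct ξ) :
    fourierCoefficient q a = ∫ t, rho (torusPoint t) (a * unitaryElt q⁻¹) ∂haarTorus d := rfl

theorem norm_fourierCoefficient_le (q : Zd d) (a : CrossedProduct ξ) :
    ‖fourierCoefficient q a‖ ≤ ‖a‖ := by
  rw [fourierCoefficient_eq]
  refine (norm_integral_le_of_norm_le_const (C := ‖a‖) (ae_of_all _ fun t => ?_)).trans ?_
  · exact (norm_rho_le _ _).trans (norm_mul_unitaryElt a _).le
  · simp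

/-- The Fourier coefficient `Φ_q` as a bounded operator. -/
noncomputable def fourierCLM (q : Zd d) : CrossedProduct ξ →L[ℂ] CrossedProduct ξ :=
  LinearMap.mkContinuous
    { toFun := fourierCoefficient q
      map_add' := fun a b => by
        simp only [fourierCoefficient_eq, add_mul, map_add]
        exact integral_add (integrable_rho _) (integrable_rho _)
      map_smul' := fun c a => by
        simp only [fourierCoefficient_eq, smul_mul_assoc, map_smul, integral_smul,
          RingHom.id_apply] }
    1 fun a => by rw [one_mul]; exact norm_fourierCoefficient_le q a

@[simp] theorem fourierCLM_apply (q : Zd d) (a : CrossedProduct ξ) :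
    fourierCLM q a = fourierCoefficient q a := rfl

/-- `Φ_q` intertwines `ρ_λ` with the character `λ^q`, by the invariance of Haar measure. -/
theorem fourierCoefficient_rho (q : Zd d) (l : Torus d) (a : CrossedProduct ξ) :
    fourierCoefficient q (rho l a) = (character l q : ℂ) • fourierCoefficient q a := by
  obtain ⟨s, rfl⟩ := surjective_torusPoint l
  have h : rho (torusPoint s) a * unitaryElt q⁻¹ = (character (torusPoint s) q : ℂ) •
      rho (torusPoint s) (a * unitaryElt q⁻¹) := by
    rw [map_mul, rho_unitaryElt, mul_smul_comm, smul_smul, map_inv, ← Circle.coe_mul,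
      mul_inv_cancel, Circle.coe_one, one_smul]
  simp only [fourierCoefficient_eq, h, map_smul, integral_smul, ← rho_mul, ← torusPoint_add]
  congr 1
  exact integral_add_right_eq_self (μ := haarTorus d)
    (fun t => rho (torusPoint t) (a * unitaryElt q⁻¹)) s

/-- `Φ_q(a) u_q` is the Fourier coefficient of the function `λ ↦ ρ_λ(a)` on the torus. -/
theorem fourierCoefficient_mul_unitaryElt (q : Zd d) (a : CrossedProduct ξ) :
    fourierCoefficient q a * unitaryElt q =
      ∫ t, UnitAddTorus.mFourier (-q.toAdd) t • rho (torusPoint t) a ∂haarTorus d := by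
  rw [fourierCoefficient_eq]
  have h := (((ContinuousLinearMap.mul ℂ (CrossedProduct ξ)).flip
    (unitaryElt q)).integral_comp_comm (integrable_rho (a * unitaryElt q⁻¹))).symm
  simp only [ContinuousLinearMap.flip_apply, ContinuousLinearMap.mul_apply'] at h
  rw [h]
  refine integral_congr_ae (ae_of_all _ fun t => ?_)
  simp only
  rw [map_mul, rho_unitaryElt, mul_smul_comm, smul_mul_assoc, mul_assoc, ← unitaryElt_mul,
    inv_mul_cancel, unitaryElt_one, mul_one, character_torusPoint, toAdd_inv]

theorem norm_fourierCoefficient_star (q : Zd d) (a : CrossedProduct ξ) :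
    ‖fourierCoefficient q (star a)‖ = ‖fourierCoefficient q⁻¹ a‖ := by
  rw [← norm_mul_unitaryElt _ q, ← norm_mul_unitaryElt (fourierCoefficient q⁻¹ a) q⁻¹,
    fourierCoefficient_mul_unitaryElt, fourierCoefficient_mul_unitaryElt, ← norm_star]
  congr 1
  have h := ((starL' ℝ : CrossedProduct ξ ≃L[ℝ] CrossedProduct ξ)).integral_comp_comm
    (μ := haarTorus d) fun t => UnitAddTorus.mFourier (-q.toAdd) t • rho (torusPoint t) (star a)
  simp only [starL'_apply] at h
  rw [← h]
  refine integral_congr_ae (ae_of_all _ fun t => ?_)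
  simp [UnitAddTorus.mFourier_neg, map_star]

/-- If the Fourier coefficients of `a` are summable, then `ρ_λ(a) = ∑_q λ^q Φ_q(a) u_q`: every
bounded linear functional takes both sides to the same value, by Fourier inversion for scalar
functions. -/
theorem hasSum_fourier (a : CrossedProduct ξ) (l : Torus d)
    (hs : Summable fun q : Fin d → ℤ => ‖fourierCoefficient (.ofAdd q) a‖) :
    HasSum (fun q : Fin d → ℤ => (∏ j, (l j : ℂ) ^ q j) •
      (fourierCoefficient (.ofAdd q) a * unitaryElt (.ofAdd q))) (rho l a) := by
  obtain ⟨t, rfl⟩ := surjective_torusPoint l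
  have hchar : ∀ q : Fin d → ℤ, ∏ j, (torusPoint t j : ℂ) ^ q j = UnitAddTorus.mFourier q t :=
    fun q => by
      rw [← toAdd_ofAdd q, ← character_torusPoint, coe_character]
  have hs' : Summable fun q : Fin d → ℤ => (∏ j, (torusPoint t j : ℂ) ^ q j) •
      (fourierCoefficient (.ofAdd q) a * unitaryElt (.ofAdd q)) := by
    refine Summable.of_norm_bounded hs fun q => ?_
    rw [norm_smul, norm_mul_unitaryElt, norm_prod]
    simp only [norm_zpow, Circle.norm_coe, one_zpow, Finset.prod_const_one, one_mul, le_refl]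
  convert hs'.hasSum using 1
  refine (SeparatingDual.eq_iff_forall_dual_eq (R := ℂ)).mpr fun φ => ?_
  let f : C(UnitAddTorus (Fin d), ℂ) :=
    ⟨fun s => φ (rho (torusPoint s) a),
      φ.continuous.comp ((continuous_rho a).comp continuous_torusPoint)⟩
  have hf : ∀ q, UnitAddTorus.mFourierCoeff f q =
      φ (fourierCoefficient (.ofAdd q) a * unitaryElt (.ofAdd q)) := fun q => by
    rw [fourierCoefficient_mul_unitaryElt]
    refine Eq.trans ?_ (φ.integral_comp_comm ?_)
    · refine integral_congr_ae (ae_of_all _ fun s => ?_)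
      simp [f]
    · exact (((UnitAddTorus.mFourier _).continuous).smul ((continuous_rho a).comp
        continuous_torusPoint)).integrable_of_hasCompactSupport
        (HasCompactSupport.of_compactSpace _)
  have hfs : Summable (UnitAddTorus.mFourierCoeff f) := by
    refine Summable.of_norm_bounded (hs.mul_left ‖φ‖) fun q => ?_
    rw [hf]
    exact (φ.le_opNorm _).trans_eq (by rw [norm_mul_unitaryElt])
  refine (UnitAddTorus.hasSum_mFourier_series_apply_of_summable hfs t).unique ?_
  have hterm : ∀ q, UnitAddTorus.mFourierCoeff f q • UnitAddTorus.mFourier q t =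
      φ ((∏ j, (torusPoint t j : ℂ) ^ q j) •
        (fourierCoefficient (.ofAdd q) a * unitaryElt (.ofAdd q))) := fun q => by
    rw [hf, map_smul, hchar, smul_eq_mul, smul_eq_mul, mul_comm]
  simp only [hterm]
  exact hs'.hasSum.mapL φ

/-! ### Strips around the torus and the length of a lattice point -/

theorem isOpen_strip (d : ℕ) (ε : ℝ) : IsOpen (strip d ε) := by
  have : strip d ε = ⋂ j, {z : Fin d → ℂ | 1 - ε < ‖z j‖ ∧ ‖z j‖ < 1 + ε} := by
    ext; simp [strip]
  rw [this]
  refine isOpen_iInter_of_finite fun j => ?_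
  have hc : Continuous fun z : Fin d → ℂ => ‖z j‖ := by fun_prop
  exact (isOpen_lt continuous_const hc).inter (isOpen_lt hc continuous_const)

theorem strip_mono {d : ℕ} {ε ε' : ℝ} (h : ε ≤ ε') : strip d ε ⊆ strip d ε' := fun z hz j =>
  ⟨by linarith [(hz j).1], by linarith [(hz j).2]⟩

theorem torus_mem_strip {ε : ℝ} (hε : 0 < ε) (l : Torus d) :
    (fun j => (l j : ℂ)) ∈ strip d ε := fun j => by
  simp only [Circle.norm_coe]; constructor <;> linarith

theorem ne_zero_of_mem_strip {ε : ℝ} (hε : ε ≤ 1) {z : Fin d → ℂ} (hz : z ∈ strip d ε) (j : Fin d) :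
    z j ≠ 0 := norm_pos_iff.mp (by linarith [(hz j).1])

/-- Every open set that contains the torus contains a strip, by compactness of the torus. -/
theorem exists_strip_subset {U : Set (Fin d → ℂ)} (hU : IsOpen U)
    (h : ∀ l : Torus d, (fun j => (l j : ℂ)) ∈ U) : ∃ ε, 0 < ε ∧ ε ≤ 1 ∧ strip d ε ⊆ U := by
  have hc : IsCompact (range fun (l : Torus d) (j : Fin d) => (l j : ℂ)) :=
    isCompact_range (by fun_prop)
  obtain ⟨δ, hδ, hδU⟩ := hc.exists_thickening_subset_open hU (by rintro _ ⟨l, rfl⟩; exact h l)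
  refine ⟨min δ 1, by positivity, min_le_right _ _, fun z hz => hδU ?_⟩
  have hz0 : ∀ j, z j ≠ 0 := ne_zero_of_mem_strip (min_le_right _ _) hz
  rw [Metric.mem_thickening_iff]
  -- The point of the torus next to `z` is `(z_j / |z_j|)_j`.
  refine ⟨_, ⟨fun j => ⟨z j / (‖z j‖ : ℂ), by simp [Submonoid.unitSphere, hz0 j]⟩, rfl⟩, ?_⟩
  refine (dist_pi_lt_iff hδ).mpr fun j => ?_
  have hn : ‖z j‖ ≠ 0 := norm_ne_zero_iff.mpr (hz0 j)
  have hn' : (‖z j‖ : ℂ) ≠ 0 := by exact_mod_cast hn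
  have : z j - z j / (‖z j‖ : ℂ) = (z j / (‖z j‖ : ℂ)) * ((‖z j‖ - 1 : ℝ) : ℂ) := by
    push_cast; field_simp
  change dist (z j) (z j / (‖z j‖ : ℂ)) < δ
  rw [dist_eq_norm, this, norm_mul, norm_div, Complex.norm_real, Complex.norm_real, norm_norm,
    div_self hn, one_mul, Real.norm_eq_abs, abs_lt]
  have := hz j
  have := min_le_left δ 1
  constructor <;> linarith

theorem length_le_sum_abs (q : Zd d) : length q ≤ ∑ j, |(q.toAdd j : ℝ)| := by
  refine Real.sqrt_le_iff.mpr ⟨by positivity, ?_⟩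
  simp only [← sq_abs (Int.cast _ : ℝ)]
  exact Finset.sum_sq_le_sq_sum_of_nonneg fun j _ => abs_nonneg _

theorem sum_abs_le_mul_length (q : Zd d) : ∑ j, |(q.toAdd j : ℝ)| ≤ (d + 1) * length q := by
  have h : ∀ j ∈ Finset.univ, |(q.toAdd j : ℝ)| ≤ length q := fun j _ => by
    refine Real.abs_le_sqrt ?_
    exact Finset.single_le_sum (f := fun j => (q.toAdd j : ℝ) ^ 2) (fun _ _ => sq_nonneg _)
      (Finset.mem_univ j)
  refine (Finset.sum_le_card_nsmul _ _ _ h).trans ?_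
  have : 0 ≤ length q := Real.sqrt_nonneg _
  simp only [Finset.card_univ, Fintype.card_fin, nsmul_eq_mul]
  linarith

/-- Exponential decay may be measured in the `ℓ¹`-length of `q` instead of the Euclidean length, as
`|q| ≤ |q|₁ ≤ d |q|`. -/
theorem mem_loc_iff {a : CrossedProduct ξ} : a ∈ loc ξ ↔ ∃ C δ : ℝ, 0 < δ ∧ ∀ q : Zd d,
    ‖fourierCoefficient q a‖ ≤ C * Real.exp (-(δ * ∑ j, |(q.toAdd j : ℝ)|)) := by
  constructor
  · rintro ⟨α, hα0, hα1, C, hC⟩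
    have hlog : 0 < -Real.log α := by linarith [Real.log_neg hα0 hα1]
    -- The factor `d + 1` instead of `d` covers the case `d = 0`.
    refine ⟨C, -Real.log α / (d + 1), by positivity, fun q => ?_⟩
    have h := hC ⟨q, rfl⟩
    simp only at h
    have hC0 : 0 ≤ C := le_trans (by positivity) h
    rw [Real.rpow_neg hα0.le, inv_mul_le_iff₀ (by positivity), mul_comm] at h
    refine h.trans (mul_le_mul_of_nonneg_left ?_ hC0)
    rw [Real.rpow_def_of_pos hα0, Real.exp_le_exp, div_mul_eq_mul_div, le_neg,
      div_le_iff₀ (by positivity)]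
    nlinarith [sum_abs_le_mul_length q]
  · rintro ⟨C, δ, hδ, h⟩
    refine ⟨Real.exp (-δ), Real.exp_pos _, by simpa using hδ, C, ?_⟩
    rintro _ ⟨q, rfl⟩
    have hC0 : 0 ≤ C := by
      by_contra hC
      have := (norm_nonneg _).trans (h 1)
      nlinarith [Real.exp_pos (-(δ * ∑ j, |((1 : Zd d).toAdd j : ℝ)|))]
    simp only
    rw [← Real.exp_mul]
    calc _ ≤ Real.exp (-δ * -length q) * (C * Real.exp (-(δ * ∑ j, |(q.toAdd j : ℝ)|))) := by
          gcongr; exact h q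
      _ = C * Real.exp (δ * length q - δ * ∑ j, |(q.toAdd j : ℝ)|) := by
          rw [mul_left_comm, ← Real.exp_add]; ring_nf
      _ ≤ C * 1 := by
          gcongr
          rw [Real.exp_le_one_iff]
          nlinarith [length_le_sum_abs q]
      _ = C := mul_one C

/-! ### Exponential decay and analytic extension -/

/-- Exponential decay of the Fourier coefficients from an analytic extension. The constants
depend only on the strip and on the bound of the extension, which gives uniformity in families. -/
theorem norm_fourierCoefficient_le_of_analyticOnNhd {b : CrossedProduct ξ}
    {F : (Fin d → ℂ) → CrossedProduct ξ} {ε δ η M : ℝ} (hδ : 0 < δ) (hδη : δ < η)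
    (hη : 1 - ε ≤ Real.exp (-η)) (hη' : Real.exp η ≤ 1 + ε)
    (hF : AnalyticOnNhd ℂ F (strip d ε)) (hFb : ∀ l : Torus d, F (fun j => (l j : ℂ)) = rho l b)
    (hM : ∀ z ∈ strip d ε, ‖F z‖ ≤ M) (q : Zd d) :
    ‖fourierCoefficient q b‖ ≤ M * Real.exp (-(δ * ∑ j, |(q.toAdd j : ℝ)|)) := by
  let s : Fin d → ℝ := fun j => ((q.toAdd j).sign : ℝ)
  have hs : ∀ j, s j * q.toAdd j = |(q.toAdd j : ℝ)| := fun j => by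
    simp only [s]; exact_mod_cast Int.sign_mul_self_eq_abs (q.toAdd j)
  have hs1 : ∀ j, |s j| ≤ 1 := fun j => by
    simp only [s]
    rcases lt_trichotomy (q.toAdd j) 0 with h | h | h
    · simp [Int.sign_eq_neg_one_of_neg h]
    · simp [h]
    · simp [Int.sign_eq_one_of_pos h]
  let N : ℝ := ∑ j, |(q.toAdd j : ℝ)|
  let ψ : ℂ → Fin d → ℂ := fun ζ j => Complex.exp (Complex.I * s j * ζ)
  let U : Set ℂ := Complex.imLm ⁻¹' Ioo (-η) η
  -- The line `ψ` maps the horizontal strip `|Im ζ| < η` into the strip around the torus.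
  have hψ : ∀ ζ ∈ U, ψ ζ ∈ strip d ε := fun ζ hζ j => by
    have h1 : |ζ.im| < η := abs_lt.mpr hζ
    have h2 : |s j * ζ.im| < η := by
      rw [abs_mul]
      exact (mul_le_of_le_one_left (abs_nonneg _) (hs1 j)).trans_lt h1
    have h3 : ‖ψ ζ j‖ = Real.exp (-(s j * ζ.im)) := by
      rw [Complex.norm_exp]; congr 1; simp
    rw [h3]
    obtain ⟨h4, h5⟩ := abs_lt.mp h2
    exact ⟨hη.trans_lt (Real.exp_lt_exp.mpr (by linarith)),
      (Real.exp_lt_exp.mpr (by linarith)).trans_le hη'⟩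
  have hψa : AnalyticOnNhd ℂ ψ univ := fun ζ _ => by
    have h : ∀ j, AnalyticAt ℂ (fun ζ => ψ ζ j) ζ := fun j => by simp only [ψ]; fun_prop
    exact AnalyticAt.pi h
  have hU : IsPreconnected U := ((convex_Ioo (-η) η).linear_preimage Complex.imLm).isPreconnected
  have h0 : (0 : ℂ) ∈ U := by simp [U]; linarith
  have hG : AnalyticOnNhd ℂ (fun ζ => fourierCLM q (F (ψ ζ))) U := fun ζ hζ =>
    ((fourierCLM q).analyticAt _).comp
      (AnalyticAt.comp (hF _ (hψ ζ hζ)) (hψa ζ (mem_univ ζ)))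
  have hH : AnalyticOnNhd ℂ (fun ζ => Complex.exp (Complex.I * N * ζ) • fourierCoefficient q b) U :=
    fun ζ _ => by
      have h : AnalyticAt ℂ (fun ζ : ℂ => Complex.exp (Complex.I * N * ζ)) ζ := by fun_prop
      exact h.smul analyticAt_const
  -- On the real line `ψ` runs in the torus, where `Φ_q ∘ F` is known.
  have hreal : ∀ x : ℝ, fourierCLM q (F (ψ x)) =
      Complex.exp (Complex.I * N * x) • fourierCoefficient q b := fun x => by
    have h1 : ψ x = fun j => ((Circle.exp (s j * x) : Circle) : ℂ) := by
      ext j; simp only [ψ, Circle.coe_exp]; congr 1; push_cast; ring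
    rw [h1, hFb fun j => Circle.exp (s j * x), fourierCLM_apply, fourierCoefficient_rho,
      coe_character]
    congr 1
    simp only [Circle.coe_exp, ← Complex.exp_int_mul, ← Complex.exp_sum]
    congr 1
    simp only [N, ← hs]
    push_cast
    simp only [Finset.mul_sum, Finset.sum_mul]
    refine Finset.sum_congr rfl fun j _ => by ring
  have hfreq : ∃ᶠ ζ in 𝓝[≠] (0 : ℂ), fourierCLM q (F (ψ ζ)) =
      Complex.exp (Complex.I * N * ζ) • fourierCoefficient q b := by
    have ht : Tendsto ((↑) : ℝ → ℂ) (𝓝[≠] 0) (𝓝[≠] 0) := by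
      refine tendsto_nhdsWithin_iff.mpr ⟨?_, ?_⟩
      · exact (Complex.continuous_ofReal.tendsto' 0 0 rfl).mono_left nhdsWithin_le_nhds
      · filter_upwards [self_mem_nhdsWithin] with x hx
        simpa using hx
    exact ht.frequently (Frequently.of_forall hreal)
  -- Evaluation at `ζ = -iδ`, where `exp(i |q|₁ ζ) = exp(δ |q|₁)`.
  have hmem : (-(δ : ℂ) * Complex.I) ∈ U := by
    simp only [U, mem_preimage, Complex.imLm_coe, mem_Ioo]
    simp; constructor <;> linarith
  have heq := hG.eqOn_of_preconnected_of_frequently_eq hH hU h0 hfreq hmem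
  simp only at heq
  have hexp : Complex.exp (Complex.I * N * (-(δ : ℂ) * Complex.I)) = (Real.exp (δ * N) : ℝ) := by
    rw [Complex.ofReal_exp]; congr 1; push_cast
    linear_combination (-(N * δ) : ℂ) * Complex.I_mul_I
  rw [hexp] at heq
  have hle : Real.exp (δ * N) * ‖fourierCoefficient q b‖ ≤ M := by
    have := congrArg norm heq
    rw [norm_smul, Complex.norm_real, Real.norm_eq_abs, Real.abs_exp] at this
    rw [← this]
    exact (norm_fourierCoefficient_le q _).trans (hM _ (hψ _ hmem))
  rw [Real.exp_neg, ← div_eq_mul_inv, le_div_iff₀ (Real.exp_pos _), mul_comm]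
  exact hle

/-- The strip of width `ε` contains the points with `exp(-η) < |z_j| < exp(η)` for some `η > 0`. -/
theorem exists_exp_radius {ε : ℝ} (hε : 0 < ε) : ∃ δ η : ℝ, 0 < δ ∧ δ < η ∧
    1 - ε ≤ Real.exp (-η) ∧ Real.exp η ≤ 1 + ε := by
  have hη : 0 < Real.log (1 + ε) := Real.log_pos (by linarith)
  refine ⟨Real.log (1 + ε) / 2, Real.log (1 + ε), by positivity, by linarith, ?_, ?_⟩
  · rw [Real.exp_neg, Real.exp_log (by linarith), ← one_div, le_div_iff₀ (by linarith)]
    nlinarith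
  · rw [Real.exp_log (by linarith)]

theorem loc_subset_analyticElements : loc ξ ⊆ analyticElements ξ := by
  intro a ha
  obtain ⟨C, δ, hδ, hC⟩ := mem_loc_iff.mp ha
  let c : (Fin d → ℤ) → CrossedProduct ξ := fun q =>
    fourierCoefficient (.ofAdd q) a * unitaryElt (.ofAdd q)
  have hc : ∀ q, ‖c q‖ ≤ C * Real.exp (-(δ * ∑ j, |(q j : ℝ)|)) := fun q => by
    simp only [c, norm_mul_unitaryElt]; exact hC _
  have hsum : ∀ t : ℝ, 0 < t →
      Summable fun q : Fin d → ℤ => C * Real.exp (-(t * ∑ j, |(q j : ℝ)|)) := fun t ht => by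
    have h := summable_pow_sum_natAbs d (Real.exp_pos (-t)).le (by simpa using ht)
    refine (h.mul_left C).congr fun q => ?_
    rw [← Real.exp_nat_mul]
    congr 2
    push_cast [Nat.cast_natAbs]
    ring
  -- On this strip `|z^q| ≤ exp(δ/4 |q|₁)`; another factor `exp(δ/4 |q|₁)` is the room that
  -- `analyticAt_tsum_monomial` asks for, and `exp(-δ/2 |q|₁)` is left for summability.
  refine ⟨1 - Real.exp (-(δ / 4)), by simpa using hδ,
    fun z => ∑' q : Fin d → ℤ, (∏ j, z j ^ q j) • c q, fun z hz => ?_, fun l => ?_⟩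
  · have hz0 := ne_zero_of_mem_strip (by linarith [Real.exp_pos (-(δ / 4))]) hz
    have hlog : ∀ j, |Real.log ‖z j‖| ≤ δ / 4 := fun j => by
      have hpos := norm_pos_iff.mpr (hz0 j)
      obtain ⟨h1, h2⟩ := hz j
      rw [abs_le, Real.le_log_iff_exp_le hpos, Real.log_le_iff_le_exp hpos]
      refine ⟨by linarith, h2.le.trans ?_⟩
      -- `1 + ε = 2 - exp(-δ/4) ≤ exp(δ/4)`, because `cosh ≥ 1`.
      nlinarith [Real.add_one_le_exp (δ / 4), Real.add_one_le_exp (-(δ / 4)),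
        Real.one_le_cosh (δ / 4), Real.cosh_eq (δ / 4)]
    refine analyticAt_tsum_monomial c hz0 (r := (δ / 4).toNNReal) (by
      rw [Real.toNNReal_pos]; positivity) ?_
    rw [Real.coe_toNNReal _ (by positivity)]
    refine Summable.of_nonneg_of_le (fun q => by positivity) (fun q => ?_)
      (hsum (δ / 2) (by positivity))
    have hz1 : ‖∏ j, z j ^ q j‖ ≤ Real.exp (δ / 4 * ∑ j, |(q j : ℝ)|) := by
      rw [norm_prod, Finset.mul_sum, Real.exp_sum]
      refine Finset.prod_le_prod (fun _ _ => norm_nonneg _) fun j _ => ?_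
      have hpos := norm_pos_iff.mpr (hz0 j)
      rw [norm_zpow, ← Real.exp_log (zpow_pos hpos _), Real.log_zpow, Real.exp_le_exp]
      refine (le_abs_self _).trans ?_
      rw [abs_mul, mul_comm]
      gcongr
      exact hlog j
    calc _ ≤ C * Real.exp (-(δ * ∑ j, |(q j : ℝ)|)) * Real.exp (δ / 4 * ∑ j, |(q j : ℝ)|) *
          Real.exp (δ / 4 * ∑ j, |(q j : ℝ)|) := by
          refine mul_le_mul_of_nonneg_right (mul_le_mul (hc q) hz1 (norm_nonneg _) ?_)
            (Real.exp_pos _).le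
          exact (norm_nonneg _).trans (hc q)
      _ = C * Real.exp (-(δ / 2 * ∑ j, |(q j : ℝ)|)) := by
          rw [mul_assoc, mul_assoc, ← Real.exp_add, ← Real.exp_add]
          ring_nf
  · refine (hasSum_fourier a l ?_).tsum_eq
    exact Summable.of_nonneg_of_le (fun _ => norm_nonneg _) (fun q => hC (.ofAdd q)) (hsum δ hδ)

theorem analyticElements_subset_loc : analyticElements ξ ⊆ loc ξ := by
  rintro a ⟨ε, hε, F, hF, hFa⟩
  let ε' := min (ε / 2) 1
  have hε' : 0 < ε' := by positivity
  obtain ⟨δ, η, hδ, hδη, hη, hη'⟩ := exists_exp_radius hε'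
  -- `F` need not be bounded on its strip, but it is on a smaller strip with compact closure inside.
  have hsub : strip d ε' ⊆ Metric.closedBall 0 2 ∩ ⋂ j, {z | 1 - ε / 2 ≤ ‖z j‖ ∧
      ‖z j‖ ≤ 1 + ε / 2} := by
    intro z hz
    have h1 := min_le_left (ε / 2) 1
    have h2 := min_le_right (ε / 2) 1
    simp only [strip, mem_ofPred_eq, ε'] at hz
    refine ⟨?_, mem_iInter.mpr fun j => ⟨by linarith [(hz j).1], by linarith [(hz j).2]⟩⟩
    rw [mem_closedBall_zero_iff, pi_norm_le_iff_of_nonneg (by norm_num)]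
    intro j
    linarith [(hz j).2]
  have hK : IsCompact (Metric.closedBall (0 : Fin d → ℂ) 2 ∩ ⋂ j, {z | 1 - ε / 2 ≤ ‖z j‖ ∧
      ‖z j‖ ≤ 1 + ε / 2}) := by
    refine (isCompact_closedBall 0 2).inter_right (isClosed_iInter fun j => ?_)
    have hc : Continuous fun z : Fin d → ℂ => ‖z j‖ := by fun_prop
    exact (isClosed_le continuous_const hc).inter (isClosed_le hc continuous_const)
  obtain ⟨M, hM⟩ := hK.exists_bound_of_continuousOn (f := F) <|
    hF.continuousOn.mono fun z hz j => by
      have := mem_iInter.mp hz.2 j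
      exact ⟨by linarith [this.1], by linarith [this.2]⟩
  refine mem_loc_iff.mpr ⟨M, δ, hδ, fun q => ?_⟩
  exact norm_fourierCoefficient_le_of_analyticOnNhd hδ hδη hη hη'
    (hF.mono (strip_mono ((min_le_left _ _).trans (by linarith)))) hFa
    (fun z hz => hM z (hsub hz)) q

variable (ξ) in
theorem loc_eq_analyticElements : loc ξ = analyticElements ξ :=
  loc_subset_analyticElements.antisymm analyticElements_subset_loc

/-! ### Resolvents, holomorphic calculus and inverses -/

/-- The Fourier coefficients of the resolvents `(w - a)⁻¹` decay exponentially, uniformly for `w` in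
a compact set off the spectrum. -/
theorem exists_norm_fourierCoefficient_resolvent_le {a : CrossedProduct ξ}
    (ha : a ∈ analyticElements ξ) {K : Set ℂ} (hK : IsCompact K)
    (hKa : ∀ w ∈ K, w ∉ spectrum ℂ a) : ∃ M δ : ℝ, 0 < δ ∧ ∀ w ∈ K, ∀ q : Zd d,
      ‖fourierCoefficient q (resolvent a w)‖ ≤
        M * Real.exp (-(δ * ∑ j, |(q.toAdd j : ℝ)|)) := by
  obtain ⟨ε, hε, F, hF, hFa⟩ := ha
  let g : ℂ × (Fin d → ℂ) → CrossedProduct ξ := fun p => algebraMap ℂ _ p.1 - F p.2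
  let T : Set (Fin d → ℂ) := range fun (l : Torus d) (j : Fin d) => (l j : ℂ)
  have hT : IsCompact T := isCompact_range (by fun_prop)
  have hunit : ∀ w ∈ K, IsUnit (algebraMap ℂ (CrossedProduct ξ) w - a) := fun w hw =>
    spectrum.notMem_iff.mp (hKa w hw)
  have hgT : ∀ w (l : Torus d), g (w, fun j => (l j : ℂ)) = rho l (algebraMap ℂ _ w - a) :=
    fun w l => by simp only [g, hFa, map_sub, AlgHomClass.commutes]
  have hgc : ∀ p : ℂ × (Fin d → ℂ), p.2 ∈ strip d ε → ContinuousAt g p := fun p hp => by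
    refine ContinuousAt.sub ((algebraMapCLM ℂ (CrossedProduct ξ)).continuous.continuousAt.comp
      continuousAt_fst) ?_
    exact ContinuousAt.comp (hF p.2 hp).continuousAt continuousAt_snd
  have hgu : ∀ p ∈ K ×ˢ T, p.2 ∈ strip d ε ∧ IsUnit (g p) := by
    rintro ⟨w, _⟩ ⟨hw, l, rfl⟩
    exact ⟨torus_mem_strip hε l, by rw [hgT]; exact (hunit w hw).map (rho l)⟩
  have hic : ∀ p ∈ K ×ˢ T, ContinuousAt (fun p => Ring.inverse (g p)) p := fun p hp => by
    obtain ⟨u, hu⟩ := (hgu p hp).2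
    refine ContinuousAt.comp (g := Ring.inverse) ?_ (hgc p (hgu p hp).1)
    rw [← hu]
    exact NormedRing.inverse_continuousAt u
  obtain ⟨M, hM⟩ := (hK.prod hT).exists_bound_of_continuousOn
    fun p hp => (hic p hp).continuousWithinAt
  -- The pairs for which `w - F(z)` has a bounded inverse; a neighbourhood of `K × 𝕋^d`.
  let W : Set (ℂ × (Fin d → ℂ)) :=
    {p | p.2 ∈ strip d ε ∧ IsUnit (g p) ∧ ‖Ring.inverse (g p)‖ < M + 1}
  have hW : K ×ˢ T ⊆ interior W := fun p hp => by
    rw [mem_interior_iff_mem_nhds]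
    filter_upwards [continuousAt_snd.eventually_mem ((isOpen_strip d ε).mem_nhds (hgu p hp).1),
      (hgc p (hgu p hp).1).eventually_mem (Units.isOpen.mem_nhds (hgu p hp).2),
      (hic p hp).norm.eventually_lt continuousAt_const (by linarith [hM p hp] :
        ‖Ring.inverse (g p)‖ < M + 1)] with p' h1 h2 h3
    exact ⟨h1, h2, h3⟩
  obtain ⟨u, v, -, hv, hKu, hTv, huv⟩ := generalized_tube_lemma hK hT isOpen_interior hW
  obtain ⟨ε', hε', -, hsub⟩ := exists_strip_subset hv fun l => hTv ⟨l, rfl⟩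
  obtain ⟨δ, η, hδ, hδη, hη, hη'⟩ := exists_exp_radius hε'
  refine ⟨M + 1, δ, hδ, fun w hw q => ?_⟩
  have hmem : ∀ z ∈ strip d ε', (w, z) ∈ W := fun z hz =>
    interior_subset (huv ⟨hKu hw, hsub hz⟩)
  refine norm_fourierCoefficient_le_of_analyticOnNhd (F := fun z => Ring.inverse (g (w, z)))
    hδ hδη hη hη' (fun z hz => ?_) (fun l => ?_) (fun z hz => (hmem z hz).2.2.le) q
  · exact analyticAt_inverse_algebraMap_sub (hF z (hmem z hz).1) (hmem z hz).2.1
  · obtain ⟨x, hx⟩ := hunit w hw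
    have h1 : (rho l) (algebraMap ℂ _ w - a) =
        ((Units.map (MonoidHomClass.toMonoidHom (rho (ξ := ξ) l)) x : (CrossedProduct ξ)ˣ) :
          CrossedProduct ξ) := by
      rw [← hx]; rfl
    rw [hgT, h1, Ring.inverse_unit, resolvent, ← hx, Ring.inverse_unit, ← map_inv]
    rfl

theorem Cycle.isCompact_support (Γ : Cycle) : IsCompact Γ.support :=
  isCompact_iUnion fun k => isCompact_Icc.image_of_continuousOn (Γ.contDiffOn k).continuousOn

variable (ξ) in
theorem isStableUnderHolomorphicCalculus_loc : IsStableUnderHolomorphicCalculus (loc ξ) := by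
  rintro a ha f _ ⟨V, Γ, hV, -, hf, hΓ, rfl⟩
  rw [loc_eq_analyticElements] at ha
  obtain ⟨M, δ, hδ, hM⟩ := exists_norm_fourierCoefficient_resolvent_le ha Γ.isCompact_support
    fun w hw => (hΓ.support_subset hw).2
  have harc : ∀ k, ∀ t ∈ Icc (0 : ℝ) 1, Γ.arc k t ∈ Γ.support := fun k t ht =>
    mem_iUnion.mpr ⟨k, t, ht, rfl⟩
  let h : Fin Γ.n → ℝ → ℂ := fun k t => derivWithin (Γ.arc k) (Icc 0 1) t * f (Γ.arc k t)
  have hh : ∀ k, ContinuousOn (h k) (Icc 0 1) := fun k =>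
    ((Γ.contDiffOn k).continuousOn_derivWithin (uniqueDiffOn_Icc zero_lt_one) le_rfl).mul
      (hf.continuousOn.comp (Γ.contDiffOn k).continuousOn
        fun t ht => (hΓ.support_subset (harc k t ht)).1)
  have hr : ∀ k, ContinuousOn (fun t => resolvent a (Γ.arc k t)) (Icc 0 1) := fun k t ht => by
    have h1 : Γ.arc k t ∈ resolventSet ℂ a :=
      spectrum.notMem_iff.mp (hΓ.support_subset (harc k t ht)).2
    exact (spectrum.hasDerivAt_resolvent_const_left h1).continuousAt.comp_continuousWithinAt
      ((Γ.contDiffOn k).continuousOn t ht)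
  choose C hC using fun k => isCompact_Icc.exists_bound_of_continuousOn (hh k)
  refine mem_loc_iff.mpr ⟨‖(2 * Real.pi * Complex.I : ℂ)⁻¹‖ * ∑ k, C k * M, δ, hδ, fun q => ?_⟩
  rw [← fourierCLM_apply, map_smul, Cycle.integral, map_sum, norm_smul,
    mul_assoc ‖(2 * Real.pi * Complex.I : ℂ)⁻¹‖, Finset.sum_mul]
  gcongr
  refine norm_sum_le_of_le _ fun k _ => ?_
  have hint : IntervalIntegrable (fun t => h k t • resolvent a (Γ.arc k t)) volume 0 1 :=
    ContinuousOn.intervalIntegrable (by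
      rw [uIcc_of_le zero_le_one]; exact (hh k).smul (hr k))
  simp only [smul_smul]
  change ‖fourierCLM q (∫ t in (0 : ℝ)..1, h k t • resolvent a (Γ.arc k t))‖ ≤ _
  rw [← ContinuousLinearMap.intervalIntegral_comp_comm _ hint]
  refine (intervalIntegral.norm_integral_le_of_norm_le_const (C := C k * M *
    Real.exp (-(δ * ∑ j, |(q.toAdd j : ℝ)|))) fun t ht => ?_).trans (by simp)
  rw [uIoc_of_le zero_le_one] at ht
  have ht' := Ioc_subset_Icc_self ht
  rw [map_smul, norm_smul, mul_assoc]
  exact mul_le_mul (hC k t ht') (hM _ (harc k t ht') q) (norm_nonneg _)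
    ((norm_nonneg _).trans (hC k t ht'))

theorem inv_mem_loc (a : (CrossedProduct ξ)ˣ) (ha : (a : CrossedProduct ξ) ∈ loc ξ) :
    ((a⁻¹ : (CrossedProduct ξ)ˣ) : CrossedProduct ξ) ∈ loc ξ := by
  rw [loc_eq_analyticElements] at ha
  obtain ⟨M, δ, hδ, hM⟩ := exists_norm_fourierCoefficient_resolvent_le ha
    (isCompact_singleton (x := (0 : ℂ))) (by
      rintro _ rfl
      exact spectrum.zero_notMem ℂ a.isUnit)
  refine mem_loc_iff.mpr ⟨M, δ, hδ, fun q => ?_⟩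
  -- The resolvent at `0` is `-a⁻¹`.
  have h : resolvent (a : CrossedProduct ξ) (0 : ℂ) =
      -((a⁻¹ : (CrossedProduct ξ)ˣ) : CrossedProduct ξ) := by
    rw [resolvent, map_zero, zero_sub, ← Units.val_neg, Ring.inverse_unit, inv_neg, Units.val_neg]
  have := hM 0 rfl q
  rwa [h, ← fourierCLM_apply, map_neg, norm_neg] at this

/-! ### The dense `*`-subalgebra -/

variable (ξ) in
/-- The set `loc ξ` as a `*`-subalgebra. Sums and products are treated through analytic extensions,
adjoints through the decay of the Fourier coefficients. -/
noncomputable def locSubalgebra : StarSubalgebra ℂ (CrossedProduct ξ) where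
  carrier := loc ξ
  mul_mem' := by
    rw [loc_eq_analyticElements]
    rintro a b ⟨ε, hε, F, hF, hFa⟩ ⟨ε', hε', G, hG, hGb⟩
    exact ⟨min ε ε', by positivity, F * G, (hF.mono (strip_mono (min_le_left _ _))).mul
      (hG.mono (strip_mono (min_le_right _ _))), fun l => by simp [hFa, hGb]⟩
  add_mem' := by
    rw [loc_eq_analyticElements]
    rintro a b ⟨ε, hε, F, hF, hFa⟩ ⟨ε', hε', G, hG, hGb⟩
    exact ⟨min ε ε', by positivity, F + G, (hF.mono (strip_mono (min_le_left _ _))).add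
      (hG.mono (strip_mono (min_le_right _ _))), fun l => by simp [hFa, hGb]⟩
  algebraMap_mem' r := by
    rw [loc_eq_analyticElements]
    exact ⟨1, one_pos, fun _ => algebraMap ℂ _ r, analyticOnNhd_const, fun l => by
      simp only [AlgHomClass.commutes]⟩
  star_mem' := by
    intro a ha
    obtain ⟨C, δ, hδ, hC⟩ := mem_loc_iff.mp ha
    refine mem_loc_iff.mpr ⟨C, δ, hδ, fun q => ?_⟩
    rw [norm_fourierCoefficient_star]
    simpa using hC q⁻¹

theorem finiteSums_le_locSubalgebra : finiteSums ξ ≤ locSubalgebra ξ := by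
  refine StarAlgebra.adjoin_le ?_
  change _ ⊆ loc ξ
  rw [loc_eq_analyticElements]
  rintro _ (⟨a, rfl⟩ | ⟨q, rfl⟩)
  · exact ⟨1, one_pos, fun _ => coeff a, analyticOnNhd_const, fun l => (rho_coeff l a).symm⟩
  · refine ⟨1, one_pos, fun z => (∏ j, z j ^ q.toAdd j) • unitaryElt q, fun z hz => ?_, fun l => ?_⟩
    · refine AnalyticAt.smul (Finset.analyticAt_fun_prod
        (f := fun j (z : Fin d → ℂ) => z j ^ q.toAdd j) _ fun j _ => ?_) analyticAt_const
      exact ((ContinuousLinearMap.proj (R := ℂ) (φ := fun _ : Fin d => ℂ) j).analyticAt z).zpow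
        (ne_zero_of_mem_strip le_rfl hz j)
    · rw [rho_unitaryElt, coe_character]

end CrossedProductZd

theorem mainTheorem7 {A : Type u} [CStarAlgebra A] {d : ℕ}
    (ξ : CrossedProductZd.Zd d →* (A ≃⋆ₐ[ℂ] A)) :
    CrossedProductZd.loc ξ = CrossedProductZd.analyticElements ξ ∧
    (∃ S : StarSubalgebra ℂ (CrossedProductZd.CrossedProduct ξ),
      (S : Set (CrossedProductZd.CrossedProduct ξ)) = CrossedProductZd.loc ξ ∧
      Dense (S : Set (CrossedProductZd.CrossedProduct ξ))) ∧
    CrossedProductZd.IsStableUnderHolomorphicCalculus (CrossedProductZd.loc ξ) ∧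
    (∀ a : (CrossedProductZd.CrossedProduct ξ)ˣ,
      (a : CrossedProductZd.CrossedProduct ξ) ∈ CrossedProductZd.loc ξ →
      ((a⁻¹ : (CrossedProductZd.CrossedProduct ξ)ˣ) : CrossedProductZd.CrossedProduct ξ) ∈
        CrossedProductZd.loc ξ) :=
  ⟨CrossedProductZd.loc_eq_analyticElements ξ,
    ⟨CrossedProductZd.locSubalgebra ξ, rfl, CrossedProductZd.dense_finiteSums.mono
      CrossedProductZd.finiteSums_le_locSubalgebra⟩,
    CrossedProductZd.isStableUnderHolomorphicCalculus_loc ξ, CrossedProductZd.inv_mem_loc⟩
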